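/- Let $X$ be a complex Banach space and let $T$ be a bounded linear operator on $X$. Suppose that $T$ is power-bounded, that is, $\sup_{n\ge 0}\|T^n\|<\infty$, and mean ergodic, that is, for every $x\in X$ the averages $\frac{1}{n+1}\sum_{k=0}^{n}T^kx$ converge in norm as $n\to\infty$. For real $\alpha>0$ let $(I-T)^\alpha$ be the bounded operator defined by the absolutely convergent series $$(I-T)^\alpha=\sum_{n=0}^\infty(-1)^n\binom{\alpha}{n}T^n .$$ Then $T$ is a Ritt operator, that is, its spectral radius satisfies $r(T)\le 1$ and there exists a constant $C>0$ such that $$\|(\lambda-T)^{-1}\|\le\frac{C}{|\lambda-1|}\qquad\text{for all }\lambda\in\mathbb{C}\text{ with }|\lambda|>1,$$ if and only if, for each real $\alpha>0$ and every $x\in\operatorname{Ran}\big((I-T)^\alpha\big)$, one has $\|T^nx\|=o(n^{-\alpha})$ as $n\to\infty$. -/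

import Mathlib

open Filter Topology Asymptotics

/-- `T` is power-bounded: `sup_{n ≥ 0} ‖T ^ n‖ < ∞`. -/
def IsPowerBounded {X : Type*} [NormedAddCommGroup X] [NormedSpace ℂ X] (T : X →L[ℂ] X) : Prop :=
  ∃ M : ℝ, ∀ n : ℕ, ‖T ^ n‖ ≤ M

/-- `T` is mean ergodic: for every `x`, the averages `(n + 1)⁻¹ ∑_{k = 0}^{n} T ^ k x`
converge in norm as `n → ∞`. -/
def IsMeanErgodic {X : Type*} [NormedAddCommGroup X] [NormedSpace ℂ X] (T : X →L[ℂ] X) : Prop :=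
  ∀ x : X, ∃ y : X,
    Tendsto (fun n : ℕ => ((n : ℂ) + 1)⁻¹ • ∑ k ∈ Finset.range (n + 1), (T ^ k) x) atTop (𝓝 y)

/-- `T` is a Ritt operator: its spectral radius is at most `1`, and there is `C > 0` such that
`‖(z - T)⁻¹‖ ≤ C / |z - 1|` whenever `|z| > 1`.  By the first condition every such `z` lies in the
resolvent set, so that `resolvent T z` is the genuine inverse of `z - T`. -/
def IsRittOperator {X : Type*} [NormedAddCommGroup X] [NormedSpace ℂ X] (T : X →L[ℂ] X) : Prop :=
  spectralRadius ℂ T ≤ 1 ∧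
    ∃ C : ℝ, 0 < C ∧ ∀ z : ℂ, 1 < ‖z‖ → ‖resolvent T z‖ ≤ C / ‖z - 1‖

/-- The fractional power `(I - T) ^ α = ∑_{n ≥ 0} (-1) ^ n (α choose n) T ^ n`.  The generalized
binomial coefficients are `O(n ^ (-1 - α))`, so for power-bounded `T` on a Banach space and `α > 0`
the series converges absolutely in operator norm. -/
noncomputable def oneSubFracPow {X : Type*} [NormedAddCommGroup X] [NormedSpace ℂ X]
    (T : X →L[ℂ] X) (α : ℝ) : X →L[ℂ] X :=
  ∑' n : ℕ, (((-1 : ℝ) ^ n * Ring.choose α n : ℝ) : ℂ) • T ^ n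

/-! For power-bounded `T`, the Ritt condition is equivalent to `‖T ^ n * (1 - T)‖ = O(1/n)`, and
both directions go through this estimate.

From the resolvent bound, `exists_norm_pow_mul_one_sub_le` reads the estimate off the Taylor
coefficients of `(1 - wT)⁻³ (1 - T)`, which is dominated by a Poisson kernel. A summation by parts
extends it to `T ^ n (1 - T) ^ α = O(n ^ (-α))` in norm for `α < 1`, and splitting `T ^ n` into
halves gives every `α`. Mean ergodicity improves `O` to `o` on each vector: up to a fixed vector,
which `(1 - T) ^ α` kills, `y` is approximated by elements `(1 - T) u`, and on these there is an
extra factor `1/n`.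

Conversely, the case `α = 1` and Banach–Steinhaus give the estimate, and `exists_norm_resolvent_le`
recovers the resolvent bound by comparing `R` with `T ^ n R` for `n` of order `1 / |z - 1|`. -/

/-! ### Coefficient bounds from the Poisson kernel -/

/-- The integral over the unit circle of a nontrivial integer power vanishes. -/
lemma integral_circleMap_zpow {m : ℤ} (hm : m ≠ 0) :
    ∫ θ in (0 : ℝ)..2 * Real.pi, circleMap 0 1 θ ^ m = 0 := by
  have h := circleIntegral.integral_sub_zpow_of_ne (n := m - 1) (by omega) 0 0 1
  rw [circleIntegral] at h
  have h' : ∀ θ : ℝ, deriv (circleMap 0 1) θ • (circleMap 0 1 θ - 0) ^ (m - 1)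
      = Complex.I * circleMap 0 1 θ ^ m := fun θ ↦ by
    have h0 : circleMap 0 1 θ ≠ 0 := by simp
    rw [deriv_circleMap, sub_zero, zpow_sub_one₀ h0, smul_eq_mul]
    field_simp
  simp_rw [h', intervalIntegral.integral_const_mul] at h
  exact (mul_eq_zero.1 h).resolve_left Complex.I_ne_zero

/-- The integral of the Poisson kernel. -/
lemma integral_inv_norm_circleMap_sub_sq {r : ℝ} (h0 : 0 ≤ r) (h1 : r < 1) :
    ∫ θ in (0 : ℝ)..2 * Real.pi, (‖circleMap 0 1 θ - r‖ ^ 2)⁻¹ = 2 * Real.pi / (1 - r ^ 2) := by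
  have h := DiffContOnCl.circleAverage_poissonKernel_smul' (w := (r : ℂ)) (c := 0) (R := 1)
    (diffContOnCl_const (c := (1 : ℂ))) (by simpa [abs_of_nonneg h0] using h1)
  have hr : 0 < 1 - r ^ 2 := by nlinarith
  simp only [Real.circleAverage, sub_zero, norm_circleMap_zero, abs_one, one_pow, Complex.norm_real,
    Real.norm_eq_abs, sq_abs, Complex.real_smul, mul_one, div_eq_mul_inv,
    intervalIntegral.integral_ofReal, intervalIntegral.integral_const_mul] at h
  have h := Complex.ofReal_injective
    ((Complex.ofReal_mul _ _).trans (h.trans Complex.ofReal_one.symm))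
  have hpi : (2 * Real.pi) ≠ 0 := by positivity
  rw [eq_div_iff hr.ne', mul_comm]
  exact ((inv_mul_eq_one₀ hpi).1 h).symm

lemma norm_circleMap_sub_pos {r : ℝ} (h0 : 0 ≤ r) (h1 : r < 1) (θ : ℝ) :
    0 < ‖circleMap 0 1 θ - r‖ := by
  rw [norm_pos_iff, sub_ne_zero]
  intro h
  have := congrArg norm h
  simp [abs_of_nonneg h0] at this
  linarith

/-- A power series whose sum is dominated by the Poisson kernel has bounded coefficients. -/
lemma norm_coeff_mul_pow_le {E : Type*} [NormedAddCommGroup E] [NormedSpace ℂ E] [CompleteSpace E]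
    {c : ℕ → E} {r K : ℝ} {G : ℂ → E} (h0 : 0 ≤ r) (h1 : r < 1)
    (hs : Summable fun k ↦ r ^ k * ‖c k‖)
    (hG : ∀ z : ℂ, ‖z‖ = 1 → HasSum (fun k ↦ ((r : ℂ) / z) ^ k • c k) (G z))
    (hK : ∀ z : ℂ, ‖z‖ = 1 → ‖G z‖ ≤ K / ‖z - r‖ ^ 2) (n : ℕ) :
    r ^ n * ‖c n‖ ≤ K / (1 - r ^ 2) := by
  have hz : ∀ θ : ℝ, ‖circleMap 0 1 θ‖ = 1 := fun θ ↦ by simp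
  have hz0 : ∀ θ : ℝ, circleMap 0 1 θ ≠ 0 := fun θ ↦ by simp
  -- The shift by `n` in the exponent leaves `k = n` as the only term with nonzero integral.
  let F : ℕ → ℝ → E := fun k θ ↦ circleMap 0 1 θ ^ ((n : ℤ) - k) • ((r : ℂ) ^ k • c k)
  have hF : ∀ k θ, F k θ = circleMap 0 1 θ ^ n • (((r : ℂ) / circleMap 0 1 θ) ^ k • c k) := by
    intro k θ
    simp only [F, smul_smul, zpow_sub₀ (hz0 θ), zpow_natCast, div_pow]
    congr 1
    ring
  have hsum : HasSum (fun k ↦ ∫ θ in (0 : ℝ)..2 * Real.pi, F k θ)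
      (∫ θ in (0 : ℝ)..2 * Real.pi, circleMap 0 1 θ ^ n • G (circleMap 0 1 θ)) := by
    refine intervalIntegral.hasSum_integral_of_dominated_convergence
      (fun k _ ↦ r ^ k * ‖c k‖) (fun k ↦ ?_) (fun k ↦ ?_) ?_ ?_ ?_
    · refine Continuous.aestronglyMeasurable ?_
      refine Continuous.smul ?_ continuous_const
      exact (continuous_circleMap 0 1).zpow₀ _ fun θ ↦ Or.inl (hz0 θ)
    · refine Eventually.of_forall fun θ _ ↦ ?_
      simp [F, norm_smul, abs_of_nonneg h0]
    · exact Eventually.of_forall fun θ _ ↦ hs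
    · exact intervalIntegrable_const
    · refine Eventually.of_forall fun θ _ ↦ ?_
      simp only [hF]
      exact (hG _ (hz θ)).const_smul _
  have hne : ∀ k, k ≠ n → ∫ θ in (0 : ℝ)..2 * Real.pi, F k θ = 0 := fun k hk ↦ by
    simp only [F]
    rw [intervalIntegral.integral_smul_const, integral_circleMap_zpow (by omega), zero_smul]
  have hn : ∫ θ in (0 : ℝ)..2 * Real.pi, F n θ = (2 * Real.pi : ℝ) • ((r : ℂ) ^ n • c n) := by
    simp only [F, sub_self, zpow_zero, one_smul, intervalIntegral.integral_const, sub_zero]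
  have heq := (hasSum_single n hne).unique hsum
  rw [hn] at heq
  have hcont : Continuous fun θ : ℝ ↦ (‖circleMap 0 1 θ - r‖ ^ 2)⁻¹ := by
    refine Continuous.inv₀ (by fun_prop) fun θ ↦ ?_
    exact (pow_pos (norm_circleMap_sub_pos h0 h1 θ) 2).ne'
  have hle : ‖∫ θ in (0 : ℝ)..2 * Real.pi, circleMap 0 1 θ ^ n • G (circleMap 0 1 θ)‖
      ≤ ∫ θ in (0 : ℝ)..2 * Real.pi, K * (‖circleMap 0 1 θ - r‖ ^ 2)⁻¹ := by
    refine intervalIntegral.norm_integral_le_of_norm_le (by positivity)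
      (Eventually.of_forall fun θ _ ↦ ?_) ((continuous_const.mul hcont).intervalIntegrable _ _)
    rw [norm_smul, norm_pow, hz, one_pow, one_mul]
    exact hK _ (hz θ)
  rw [← heq, intervalIntegral.integral_const_mul, integral_inv_norm_circleMap_sub_sq h0 h1,
    norm_smul, norm_smul, norm_pow, Complex.norm_real, Real.norm_of_nonneg h0,
    Real.norm_of_nonneg (by positivity)] at hle
  have hpi : 0 < 2 * Real.pi := by positivity
  refine le_of_mul_le_mul_left ?_ hpi
  calc 2 * Real.pi * (r ^ n * ‖c n‖) ≤ K * (2 * Real.pi / (1 - r ^ 2)) := hle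
    _ = 2 * Real.pi * (K / (1 - r ^ 2)) := by ring

/-! ### Binomial coefficients of `(1 - x) ^ α` -/

/-- The `n`-th Taylor coefficient of `(1 - x) ^ α` at `0`. -/
noncomputable def oneSubPowCoeff (α : ℝ) (n : ℕ) : ℝ := (-1) ^ n * Ring.choose α n

@[simp] lemma oneSubPowCoeff_zero_right (α : ℝ) : oneSubPowCoeff α 0 = 1 := by
  simp [oneSubPowCoeff]

lemma oneSubPowCoeff_add_one_succ (α : ℝ) (n : ℕ) :
    oneSubPowCoeff (α + 1) (n + 1) = oneSubPowCoeff α (n + 1) - oneSubPowCoeff α n := by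
  simp only [oneSubPowCoeff, Ring.choose_succ_succ, pow_succ]
  ring

lemma succ_mul_oneSubPowCoeff_succ (α : ℝ) (n : ℕ) :
    (n + 1) * oneSubPowCoeff α (n + 1) = (n - α) * oneSubPowCoeff α n := by
  have h := Ring.choose_smul_choose α (Nat.le_succ n)
  simp only [Nat.succ_eq_add_one, Nat.choose_succ_self_right, nsmul_eq_mul, Nat.cast_add,
    Nat.cast_one, Nat.add_sub_cancel_left, Ring.choose_one_right] at h
  simp only [oneSubPowCoeff, pow_succ]
  linear_combination (-(-1) ^ n) * h

lemma oneSubPowCoeff_sub_one_pos {α : ℝ} (hα : α < 1) (n : ℕ) : 0 < oneSubPowCoeff (α - 1) n := by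
  induction n with
  | zero => simp
  | succ n ih =>
    have h := succ_mul_oneSubPowCoeff_succ (α - 1) n
    have h1 : 0 < ((n : ℝ) - (α - 1)) * oneSubPowCoeff (α - 1) n :=
      mul_pos (by linarith [(Nat.cast_nonneg n : (0 : ℝ) ≤ n)]) ih
    rw [← h] at h1
    exact pos_of_mul_pos_right h1 (by positivity)

lemma oneSubPowCoeff_sub_one_succ_le {α : ℝ} (h0 : 0 ≤ α) (hα : α < 1) (n : ℕ) :
    oneSubPowCoeff (α - 1) (n + 1) ≤ oneSubPowCoeff (α - 1) n := by
  have h := succ_mul_oneSubPowCoeff_succ (α - 1) n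
  have hp := oneSubPowCoeff_sub_one_pos hα n
  have hn : (0 : ℝ) < n + 1 := by positivity
  refine le_of_mul_le_mul_left ?_ hn
  nlinarith

/-- This keeps the head of the series in `norm_pow_mul_oneSubFracPow_le_of_lt_one` of the same order
as its tail. -/
lemma sum_oneSubPowCoeff_sub_one {α : ℝ} (hα : α < 1) (n : ℕ) :
    ∑ k ∈ Finset.range n, oneSubPowCoeff (α - 1) k
      = n * oneSubPowCoeff (α - 1) n / (1 - α) := by
  have h1 : 1 - α ≠ 0 := by linarith
  induction n with
  | zero => simp
  | succ n ih =>
    rw [Finset.sum_range_succ, ih]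
    push_cast
    rw [succ_mul_oneSubPowCoeff_succ]
    field_simp
    ring

lemma abs_oneSubPowCoeff_succ {α : ℝ} (h0 : 0 ≤ α) (hα : α < 1) (n : ℕ) :
    |oneSubPowCoeff α (n + 1)| = oneSubPowCoeff (α - 1) n - oneSubPowCoeff (α - 1) (n + 1) := by
  have h := oneSubPowCoeff_add_one_succ (α - 1) n
  rw [sub_add_cancel] at h
  rw [h, abs_of_nonpos (by linarith [oneSubPowCoeff_sub_one_succ_le h0 hα n])]
  ring

/-- With `t = α / (n + 1)`, the ratio of consecutive coefficients is `1 - t`, Bernoulli bounds `((n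
+ 2) / (n + 1)) ^ α` by `1 + t`, and `(1 - t) (1 + t) ≤ 1`. -/
lemma oneSubPowCoeff_sub_one_le_rpow {α : ℝ} (h0 : 0 ≤ α) (hα : α < 1) (n : ℕ) :
    oneSubPowCoeff (α - 1) n ≤ ((n : ℝ) + 1) ^ (-α) := by
  induction n with
  | zero => simp
  | succ n ih =>
    have hn : (0 : ℝ) < n + 1 := by positivity
    have hb := rpow_one_add_le_one_add_mul_self (s := 1 / ((n : ℝ) + 1))
      (by linarith [show (0 : ℝ) < 1 / ((n : ℝ) + 1) by positivity]) h0 hα.le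
    have hx : (1 + 1 / ((n : ℝ) + 1)) = ((n : ℝ) + 1 + 1) * ((n : ℝ) + 1)⁻¹ := by field_simp
    rw [hx, Real.mul_rpow (by positivity) (by positivity), Real.inv_rpow hn.le,
      ← Real.rpow_neg hn.le] at hb
    have h := succ_mul_oneSubPowCoeff_succ (α - 1) n
    have hp := oneSubPowCoeff_sub_one_pos hα n
    have hA : 0 < ((n : ℝ) + 1 + 1) ^ α := by positivity
    push_cast
    rw [Real.rpow_neg (by positivity), ← one_div, le_div_iff₀ hA]
    refine le_of_mul_le_mul_left ?_ hn
    have h3 : 0 ≤ (n : ℝ) + 1 - α := by linarith [(Nat.cast_nonneg n : (0 : ℝ) ≤ n)]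
    calc ((n : ℝ) + 1) * (oneSubPowCoeff (α - 1) (n + 1) * ((n : ℝ) + 1 + 1) ^ α)
        = ((n : ℝ) + 1 - α) * oneSubPowCoeff (α - 1) n * ((n : ℝ) + 1 + 1) ^ α := by
          rw [← mul_assoc, h]; ring
      _ ≤ ((n : ℝ) + 1 - α) * (((n : ℝ) + 1) ^ (-α)) * ((n : ℝ) + 1 + 1) ^ α := by gcongr
      _ = ((n : ℝ) + 1 - α) * (((n : ℝ) + 1 + 1) ^ α * ((n : ℝ) + 1) ^ (-α)) := by ring
      _ ≤ ((n : ℝ) + 1 - α) * (1 + α * (1 / ((n : ℝ) + 1))) := by gcongr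
      _ ≤ ((n : ℝ) + 1) * 1 := by
          rw [mul_one_div, one_add_div hn.ne', ← mul_div_assoc, div_le_iff₀ hn]
          nlinarith

/-- For `α < 1` the absolute values telescope; Pascal's rule reduces larger `α` to `α - 1`. -/
lemma summable_abs_oneSubPowCoeff {α : ℝ} (h0 : 0 ≤ α) : Summable fun n ↦ |oneSubPowCoeff α n| := by
  obtain ⟨m, hm⟩ : ∃ m : ℕ, α < m + 1 := ⟨⌊α⌋₊, Nat.lt_floor_add_one α⟩
  induction m generalizing α with
  | zero =>
    have h1 : α < 1 := by simpa using hm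
    rw [← summable_nat_add_iff 1]
    refine summable_of_sum_range_le (c := 1) (fun _ ↦ abs_nonneg _) fun n ↦ ?_
    simp_rw [abs_oneSubPowCoeff_succ h0 h1]
    rw [Finset.sum_range_sub', oneSubPowCoeff_zero_right]
    linarith [oneSubPowCoeff_sub_one_pos h1 n]
  | succ m ih =>
    rcases lt_or_ge α (m + 1) with h | h
    · exact ih h0 h
    have hs := ih (α := α - 1) (by linarith [(Nat.cast_nonneg m : (0 : ℝ) ≤ m)])
      (by push_cast at hm; linarith)
    rw [← summable_nat_add_iff 1]
    refine Summable.of_nonneg_of_le (fun _ ↦ abs_nonneg _) (fun n ↦ ?_)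
      (((summable_nat_add_iff 1).2 hs).add hs)
    have := oneSubPowCoeff_add_one_succ (α - 1) n
    rw [sub_add_cancel] at this
    rw [this]
    exact abs_sub _ _

/-! ### Power series in a normed algebra -/

section algebra

variable {A : Type*} [NormedRing A] [NormedAlgebra ℂ A]

/-- Multiplying a power series by `1 - x` takes differences of the coefficients. -/
lemma HasSum.one_sub_mul_pow_series {c d : ℕ → ℂ} {x s : A}
    (h : HasSum (fun k ↦ c k • x ^ k) s) (hd0 : d 0 = c 0)
    (hd : ∀ k, d (k + 1) = c (k + 1) - c k) :
    HasSum (fun k ↦ d k • x ^ k) ((1 - x) * s) := by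
  have hx := h.mul_left x
  rw [← hasSum_nat_add_iff' 1] at h ⊢
  simp only [Finset.sum_range_one, pow_zero] at h ⊢
  have he : (1 - x) * s - d 0 • (1 : A) = s - c 0 • (1 : A) - x * s := by rw [hd0]; noncomm_ring
  rw [he]
  refine (h.sub hx).congr_fun fun k ↦ ?_
  rw [hd, sub_smul, mul_smul_comm, ← pow_succ']

/-- Summation by parts for the partial sums of the series of `(1 - x) ^ α`. -/
lemma sum_oneSubPowCoeff_smul_pow (α : ℝ) (x : A) (n : ℕ) :
    ∑ k ∈ Finset.range (n + 1), (oneSubPowCoeff α k : ℂ) • x ^ k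
      = (oneSubPowCoeff (α - 1) n : ℂ) • x ^ n
        + ∑ k ∈ Finset.range n, (oneSubPowCoeff (α - 1) k : ℂ) • ((1 - x) * x ^ k) := by
  induction n with
  | zero => simp
  | succ n ih =>
    have h := oneSubPowCoeff_add_one_succ (α - 1) n
    rw [sub_add_cancel] at h
    rw [Finset.sum_range_succ, ih, Finset.sum_range_succ _ n, h, sub_mul, one_mul, ← pow_succ']
    push_cast
    module

end algebra

/-! ### The resolvent bound and the decay of `T ^ n * (1 - T)` -/

section algebra

variable {A : Type*} [NormedRing A] [NormedAlgebra ℂ A]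

lemma norm_natCast_smul_pow_smul_le {T : A} {M : ℝ} (hM : ∀ n, ‖T ^ n‖ ≤ M) (m : ℕ) (w : ℂ)
    (k : ℕ) : ‖(((k + m).choose m : ℕ) : ℂ) • (w • T) ^ k‖ ≤ M * (((k + m).choose m) * ‖w‖ ^ k) := by
  rw [smul_pow, norm_smul, norm_smul, norm_pow, Complex.norm_natCast]
  calc ((k + m).choose m : ℝ) * (‖w‖ ^ k * ‖T ^ k‖)
      ≤ ((k + m).choose m : ℝ) * (‖w‖ ^ k * M) := by gcongr; exact hM k
    _ = _ := by ring

variable [CompleteSpace A]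

lemma summable_choose_smul_pow {T : A} {M : ℝ} (hM : ∀ n, ‖T ^ n‖ ≤ M) (m : ℕ) {w : ℂ}
    (hw : ‖w‖ < 1) : Summable fun k ↦ (((k + m).choose m : ℕ) : ℂ) • (w • T) ^ k := by
  refine Summable.of_norm_bounded ?_ (norm_natCast_smul_pow_smul_le hM m w)
  exact (summable_choose_mul_geometric_of_norm_lt_one m (by simpa using hw)).mul_left M

lemma summable_smul_pow {T : A} {M : ℝ} (hM : ∀ n, ‖T ^ n‖ ≤ M) {w : ℂ} (hw : ‖w‖ < 1) :
    Summable fun k ↦ (w • T) ^ k := by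
  simpa using summable_choose_smul_pow hM 0 hw

/-- The negative binomial series at a point of the disc, for a power-bounded element. -/
lemma hasSum_choose_smul_pow {T : A} {M : ℝ} (hM : ∀ n, ‖T ^ n‖ ≤ M) (m : ℕ) {w : ℂ}
    (hw : ‖w‖ < 1) :
    HasSum (fun k ↦ (((k + m).choose m : ℕ) : ℂ) • (w • T) ^ k) ((∑' k, (w • T) ^ k) ^ (m + 1)) := by
  have hS := summable_smul_pow hM hw
  induction m with
  | zero => simpa using hS.hasSum
  | succ m ih =>
    have h := (summable_choose_smul_pow hM (m + 1) hw).hasSum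
    -- By Pascal's rule, multiplying by `1 - wT` lowers `m + 1` to `m`; multiplying back by its
    -- inverse closes the induction.
    have h' : HasSum (fun k ↦ (((k + m).choose m : ℕ) : ℂ) • (w • T) ^ k) _ :=
      h.one_sub_mul_pow_series (by simp) fun k ↦ by
        rw [eq_sub_iff_add_eq, ← Nat.cast_add, show k + 1 + m = k + (m + 1) by ring,
          show k + 1 + (m + 1) = k + (m + 1) + 1 by ring, Nat.choose_succ_succ]
    have he := h'.unique ih
    rw [pow_succ', ← he, ← mul_assoc, hS.tsum_pow_mul_one_sub, one_mul]
    exact h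

lemma mul_eq_one_of_one_lt_norm {T : A} {M : ℝ} (hM : ∀ n, ‖T ^ n‖ ≤ M) {z : ℂ}
    (hz : 1 < ‖z‖) :
    (algebraMap ℂ A z - T) * (z⁻¹ • ∑' k, (z⁻¹ • T) ^ k) = 1 ∧
      (z⁻¹ • ∑' k, (z⁻¹ • T) ^ k) * (algebraMap ℂ A z - T) = 1 := by
  have hz0 : z ≠ 0 := by rintro rfl; simp at hz; linarith
  have hS := summable_smul_pow hM (w := z⁻¹) (by rw [norm_inv]; exact inv_lt_one_of_one_lt₀ hz)
  have he : algebraMap ℂ A z - T = z • (1 - z⁻¹ • T) := by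
    rw [smul_sub, smul_smul, mul_inv_cancel₀ hz0, one_smul, Algebra.algebraMap_eq_smul_one]
  rw [he]
  constructor
  · rw [smul_mul_smul_comm, mul_inv_cancel₀ hz0, one_smul, hS.one_sub_mul_tsum_pow]
  · rw [smul_mul_smul_comm, inv_mul_cancel₀ hz0, one_smul, hS.tsum_pow_mul_one_sub]

lemma mem_resolventSet_of_one_lt_norm {T : A} {M : ℝ} (hM : ∀ n, ‖T ^ n‖ ≤ M) {z : ℂ}
    (hz : 1 < ‖z‖) : z ∈ resolventSet ℂ T :=
  spectrum.mem_resolventSet_of_left_right_inverse (mul_eq_one_of_one_lt_norm hM hz).1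
    (mul_eq_one_of_one_lt_norm hM hz).2

/-- The Neumann series of the resolvent of a power-bounded element. -/
lemma resolvent_eq_smul_tsum {T : A} {M : ℝ} (hM : ∀ n, ‖T ^ n‖ ≤ M) {z : ℂ} (hz : 1 < ‖z‖) :
    resolvent T z = z⁻¹ • ∑' k, (z⁻¹ • T) ^ k := by
  obtain ⟨h1, h2⟩ := mul_eq_one_of_one_lt_norm hM hz
  exact Ring.inverse_unit ⟨_, _, h1, h2⟩

lemma spectralRadius_le_one_of_pow_bounded {T : A} {M : ℝ} (hM : ∀ n, ‖T ^ n‖ ≤ M) :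
    spectralRadius ℂ T ≤ 1 := by
  refine iSup₂_le fun z hz ↦ ?_
  by_contra! h
  refine hz (mem_resolventSet_of_one_lt_norm hM ?_)
  exact_mod_cast h

/-- The resolvent bound of a Ritt operator controls the differences of its powers. -/
lemma exists_norm_pow_mul_one_sub_le {T : A} {M C : ℝ} (hM : ∀ n, ‖T ^ n‖ ≤ M) (hC : 0 < C)
    (h : ∀ z : ℂ, 1 < ‖z‖ → ‖resolvent T z‖ ≤ C / ‖z - 1‖) :
    ∃ K : ℝ, ∀ n : ℕ, ((n : ℝ) + 1) * ‖T ^ n * (1 - T)‖ ≤ K := by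
  set B : ℝ := C ^ 2 * (‖(1 : A)‖ + C) with hB
  -- The cube matters: two resolvent factors give the Poisson kernel, of integral about `n`, against
  -- a coefficient of order `n ^ 2`. The square would lose a logarithm.
  have key : ∀ r : ℝ, 0 < r → r < 1 → ∀ n : ℕ,
      r ^ n * ‖(((n + 2).choose 2 : ℕ) : ℂ) • (T ^ n * (1 - T))‖ ≤ B / r / (1 - r ^ 2) := by
    intro r h0 h1 n
    refine norm_coeff_mul_pow_le (c := fun k ↦ (((k + 2).choose 2 : ℕ) : ℂ) • (T ^ k * (1 - T)))
      (G := fun z ↦ (∑' k, (((r : ℂ) / z) • T) ^ k) ^ 3 * (1 - T)) h0.le h1 ?_ ?_ ?_ n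
    · refine Summable.of_nonneg_of_le (fun _ ↦ by positivity) (fun k ↦ ?_)
        ((summable_choose_mul_geometric_of_norm_lt_one 2 (r := r)
          (by rwa [Real.norm_of_nonneg h0.le])).mul_left (M * ‖1 - T‖))
      rw [norm_smul, Complex.norm_natCast]
      calc r ^ k * (((k + 2).choose 2 : ℕ) * ‖T ^ k * (1 - T)‖)
          ≤ r ^ k * (((k + 2).choose 2 : ℕ) * (M * ‖1 - T‖)) := by
            gcongr
            exact (norm_mul_le _ _).trans (by gcongr; exact hM k)
        _ = _ := by ring
    · intro z hz
      have hw : ‖(r : ℂ) / z‖ < 1 := by simpa [hz, abs_of_pos h0] using h1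
      refine ((hasSum_choose_smul_pow hM 2 hw).mul_right (1 - T)).congr_fun fun k ↦ ?_
      rw [smul_pow, smul_mul_assoc, smul_mul_assoc, smul_comm]
    · intro z hz
      have hz0 : z ≠ 0 := by rintro rfl; simp at hz
      have hr0 : (r : ℂ) ≠ 0 := by exact_mod_cast h0.ne'
      set w : ℂ := (r : ℂ) / z with hw_def
      have hwn : ‖w‖ = r := by simp [hw_def, hz, abs_of_pos h0]
      set S := ∑' k, (w • T) ^ k with hS_def
      have hzr : 0 < ‖z - r‖ := by
        rw [norm_pos_iff, sub_ne_zero]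
        rintro rfl
        rw [Complex.norm_real, Real.norm_of_nonneg h0.le] at hz
        linarith
      have hw1 : ‖1 - w‖ = ‖z - r‖ := by
        rw [hw_def, one_sub_div hz0, norm_div, hz, div_one]
      have hSn : ‖S‖ ≤ C / ‖z - r‖ := by
        have hwi : 1 < ‖w⁻¹‖ := by
          rw [norm_inv, hwn]; exact one_lt_inv_iff₀.2 ⟨h0, h1⟩
        have hb := h w⁻¹ hwi
        rw [resolvent_eq_smul_tsum hM hwi, inv_inv, ← hS_def, norm_smul, hwn] at hb
        have hw0 : w ≠ 0 := div_ne_zero hr0 hz0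
        have he : ‖w⁻¹ - 1‖ = ‖z - r‖ / r := by
          rw [← hw1, ← hwn, ← norm_div, sub_div, div_self hw0, one_div]
        rw [he, div_div_eq_mul_div, mul_comm C r, mul_div_assoc] at hb
        exact le_of_mul_le_mul_left hb h0
      -- One factor `S` is absorbed by `1 - T`, since `w S (1 - T) = 1 - (1 - w) S` and `(1 - w) S`
      -- is bounded by `C`.
      have hSA : ‖S * (1 - T)‖ ≤ (‖(1 : A)‖ + C) / r := by
        have hS1 : S * (1 - w • T) = 1 :=
          (summable_smul_pow hM (by rw [hwn]; exact h1)).tsum_pow_mul_one_sub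
        have he : w • (S * (1 - T)) = 1 - (1 - w) • S := by
          rw [mul_sub, mul_one, mul_smul_comm, sub_eq_iff_eq_add, ← sub_eq_iff_eq_add'] at hS1
          rw [mul_sub, mul_one, smul_sub, ← hS1]
          module
        rw [le_div_iff₀ h0, mul_comm, ← hwn, ← norm_smul, he]
        refine (norm_sub_le _ _).trans ?_
        gcongr
        rw [norm_smul, hw1]
        calc ‖z - r‖ * ‖S‖ ≤ ‖z - r‖ * (C / ‖z - r‖) := by gcongr
          _ = C := by field_simp
      calc ‖S ^ 3 * (1 - T)‖ = ‖S * (S * (S * (1 - T)))‖ := by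
            congr 1; noncomm_ring
        _ ≤ ‖S‖ * (‖S‖ * ‖S * (1 - T)‖) :=
            (norm_mul_le _ _).trans (by gcongr; exact norm_mul_le _ _)
        _ ≤ C / ‖z - r‖ * (C / ‖z - r‖ * ((‖(1 : A)‖ + C) / r)) := by gcongr
        _ = B / r / ‖z - r‖ ^ 2 := by rw [hB]; field_simp
  refine ⟨6 * B, fun n ↦ ?_⟩
  have hn : (0 : ℝ) < n + 1 := by positivity
  have hn2 : (0 : ℝ) < n + 2 := by positivity
  -- At this radius `r ^ (n + 1) ≥ 1 / e ≥ 1 / 3` and `1 - r ^ 2 ≥ 1 / (n + 2)`; with the `1 / 2` in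
  -- the binomial coefficient this gives the factor `6`.
  set r : ℝ := (n + 1) / (n + 2) with hr
  have h0 : 0 < r := by positivity
  have h1 : r < 1 := by rw [hr, div_lt_one hn2]; linarith
  have hk := key r h0 h1 n
  have hexp : 1 / 3 ≤ r ^ (n + 1) := by
    have hi : r⁻¹ ≤ Real.exp (1 / (n + 1)) := by
      have := Real.add_one_le_exp (1 / ((n : ℝ) + 1))
      have he : r⁻¹ = 1 / ((n : ℝ) + 1) + 1 := by rw [hr]; field_simp; ring
      rwa [he]
    have hp : (r⁻¹) ^ (n + 1) ≤ Real.exp 1 := by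
      calc (r⁻¹) ^ (n + 1) ≤ Real.exp (1 / (n + 1)) ^ (n + 1) := by gcongr
        _ = Real.exp 1 := by
          rw [← Real.exp_nat_mul]; congr 1; push_cast; field_simp
    rw [inv_pow] at hp
    rw [one_div, inv_le_comm₀ (by norm_num) (by positivity)]
    exact hp.trans (by linarith [Real.exp_one_lt_d9])
  have hr2 : 1 / ((n : ℝ) + 2) ≤ 1 - r ^ 2 := by
    have : 1 - r = 1 / ((n : ℝ) + 2) := by rw [hr]; field_simp; ring
    nlinarith
  have hr2' : 0 < 1 - r ^ 2 := lt_of_lt_of_le (by positivity) hr2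
  rw [norm_smul, Complex.norm_natCast, Nat.cast_choose_two, div_div,
    le_div_iff₀ (by positivity)] at hk
  push_cast at hk
  set N := ‖T ^ n * (1 - T)‖
  have hN : 0 ≤ N := norm_nonneg _
  have hpos : 0 ≤ (n + 2 : ℝ) * (n + 1) / 2 * N := by positivity
  calc (n + 1) * N = 6 * ((n + 2 : ℝ) * (n + 1) / 2 * N * (1 / 3 * (1 / ((n : ℝ) + 2)))) := by
        field_simp; ring
    _ ≤ 6 * ((n + 2 : ℝ) * (n + 1) / 2 * N * (r ^ (n + 1) * (1 - r ^ 2))) := by gcongr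
    _ = 6 * (r ^ n * ((n + 2 : ℝ) * (n + 2 - 1) / 2 * N) * (r * (1 - r ^ 2))) := by ring
    _ ≤ 6 * B := by gcongr

/-- Decay of the differences of the powers gives the resolvent bound of a Ritt operator. -/
lemma exists_norm_resolvent_le {T : A} {M K : ℝ} (hM : ∀ n, ‖T ^ n‖ ≤ M)
    (hK : ∀ n : ℕ, n * ‖T ^ n * (1 - T)‖ ≤ K) :
    ∃ C : ℝ, 0 < C ∧ ∀ z : ℂ, 1 < ‖z‖ → ‖resolvent T z‖ ≤ C / ‖z - 1‖ := by
  have hM0 : 0 ≤ M := (norm_nonneg _).trans (hM 0)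
  have hK0 : 0 ≤ K := by simpa using hK 0
  refine ⟨2 * (2 * K + 8 * M + 1) * M + 2 * M + 1, by positivity, fun z hz ↦ ?_⟩
  have hz0 : z ≠ 0 := by rintro rfl; simp at hz; linarith
  have hz1 : 0 < ‖z - 1‖ := by
    rw [norm_pos_iff, sub_ne_zero]; rintro rfl; simp at hz
  have h1 := (mul_eq_one_of_one_lt_norm hM hz).1
  rw [← resolvent_eq_smul_tsum hM hz] at h1
  set R := resolvent T z
  have hR : z • R - T * R = 1 := by rw [← h1, sub_mul, Algebra.smul_def]
  have hDR : (z - 1) • R = 1 - (1 - T) * R := by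
    have hTR : T * R = z • R - 1 := by rw [← hR]; abel
    rw [sub_mul, one_mul, hTR, sub_smul, one_smul]; abel
  have hone : ‖(1 : A)‖ ≤ M := by simpa using hM 0
  -- The difference is the partial Neumann sum of `z⁻¹ ^ (k + 1) • T ^ k` over `k < n`.
  have hstep : ∀ n : ℕ, ‖R - (z⁻¹) ^ n • (T ^ n * R)‖ ≤ n * M := by
    intro n
    induction n with
    | zero => simp
    | succ n ih =>
      have he : R - (z⁻¹) ^ (n + 1) • (T ^ (n + 1) * R)
          = (R - (z⁻¹) ^ n • (T ^ n * R)) + (z⁻¹) ^ (n + 1) • T ^ n := by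
        have h3 : T ^ n = z • (T ^ n * R) - T ^ (n + 1) * R := by
          rw [pow_succ, mul_assoc, ← mul_smul_comm, ← mul_sub, hR, mul_one]
        have h4 : (z⁻¹) ^ (n + 1) • T ^ n
            = (z⁻¹) ^ n • (T ^ n * R) - (z⁻¹) ^ (n + 1) • (T ^ (n + 1) * R) := by
          nth_rewrite 1 [h3]
          rw [smul_sub, smul_smul, pow_succ, mul_assoc, inv_mul_cancel₀ hz0, mul_one]
        rw [h4]; abel
      have h5 : ‖(z⁻¹) ^ (n + 1) • T ^ n‖ ≤ M := by
        rw [norm_smul, norm_pow, norm_inv]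
        calc (‖z‖⁻¹) ^ (n + 1) * ‖T ^ n‖ ≤ 1 * M := by
              gcongr
              · exact pow_le_one₀ (by positivity) (inv_le_one_of_one_le₀ hz.le)
              · exact hM n
          _ = M := one_mul M
      rw [he]
      refine (norm_add_le _ _).trans ?_
      push_cast
      linarith
  have hDn : ‖1 - T‖ ≤ 2 * M := by
    have := norm_sub_le 1 T
    have h1 : ‖T‖ ≤ M := by simpa using hM 1
    linarith
  set a := ‖z - 1‖ with ha
  have hRn : 0 ≤ ‖R‖ := norm_nonneg R
  rw [le_div_iff₀ hz1, mul_comm]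
  -- Far from `1`, `‖1 - T‖ ≤ 2 * M ≤ a / 2` already absorbs `‖R‖`.
  rcases lt_or_ge (4 * M) a with hbig | hsmall
  · have h6 : a * ‖R‖ ≤ M + 2 * M * ‖R‖ := by
      rw [ha, ← norm_smul, hDR]
      refine (norm_sub_le _ _).trans (add_le_add hone ((norm_mul_le _ _).trans ?_))
      gcongr
    have h7 : 4 * M * ‖R‖ ≤ a * ‖R‖ := by gcongr
    have h8 : 0 ≤ 2 * (2 * K + 8 * M + 1) * M := by positivity
    nlinarith
  -- Large enough for `‖T ^ n * (1 - T)‖ ≤ a / 2`, so that half of `a * ‖R‖` is absorbed, yet `a *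
  -- n` stays bounded.
  · set n : ℕ := ⌈2 * K / a⌉₊ + 1 with hn
    have hn1 : 2 * K / a ≤ n := by
      rw [hn]; push_cast; linarith [Nat.le_ceil (2 * K / a)]
    have hn2 : (n : ℝ) ≤ 2 * K / a + 2 := by
      rw [hn]; push_cast
      linarith [(Nat.ceil_lt_add_one (by positivity : 0 ≤ 2 * K / a)).le]
    have hn0 : (0 : ℝ) < n := by rw [hn]; positivity
    have hTD : ‖T ^ n * (1 - T)‖ ≤ a / 2 := by
      have h9 : (n : ℝ) * ‖T ^ n * (1 - T)‖ ≤ n * (a / 2) := by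
        refine (hK n).trans ?_
        rw [div_le_iff₀ hz1] at hn1
        linarith
      exact le_of_mul_le_mul_left h9 hn0
    have h10 : a * ‖T ^ n * R‖ ≤ M + a / 2 * ‖R‖ := by
      rw [ha, ← norm_smul, ← mul_smul_comm, hDR, mul_sub, mul_one, ← mul_assoc]
      refine (norm_sub_le _ _).trans (add_le_add (hM n) ((norm_mul_le _ _).trans ?_))
      gcongr
    have h11 : ‖R‖ ≤ n * M + ‖T ^ n * R‖ := by
      have h12 : ‖(z⁻¹) ^ n • (T ^ n * R)‖ ≤ ‖T ^ n * R‖ := by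
        rw [norm_smul, norm_pow, norm_inv]
        exact mul_le_of_le_one_left (norm_nonneg _)
          (pow_le_one₀ (by positivity) (inv_le_one_of_one_le₀ hz.le))
      have h13 := norm_add_le (R - (z⁻¹) ^ n • (T ^ n * R)) ((z⁻¹) ^ n • (T ^ n * R))
      rw [sub_add_cancel] at h13
      linarith [hstep n]
    have h14 : a * n ≤ 2 * K + 2 * a := by
      calc a * n ≤ a * (2 * K / a + 2) := by gcongr
        _ = 2 * K + 2 * a := by field_simp
    have h15 : a * ‖R‖ ≤ a * (n * M + ‖T ^ n * R‖) := by gcongr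
    have h16 : a * n * M ≤ (2 * K + 8 * M) * M := by
      gcongr
      linarith
    linarith

end algebra

/-! ### Decay on the ranges of the fractional powers -/

section operators

variable {X : Type*} [NormedAddCommGroup X] [NormedSpace ℂ X]

/-- Limits of ergodic averages are fixed vectors. -/
lemma apply_eq_of_tendsto_average {T : X →L[ℂ] X} {M : ℝ} (hM : ∀ n, ‖T ^ n‖ ≤ M) {y p : X}
    (hp : Tendsto (fun n : ℕ ↦ ((n : ℂ) + 1)⁻¹ • ∑ k ∈ Finset.range (n + 1), (T ^ k) y) atTop
      (𝓝 p)) : T p = p := by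
  have h1 := (T.continuous.tendsto p).comp hp
  have h2 : Tendsto (fun n : ℕ ↦ ((n : ℂ) + 1)⁻¹ • ((T ^ (n + 1)) y - y)) atTop (𝓝 0) := by
    have h3 : Tendsto (fun n : ℕ ↦ 1 / ((n : ℝ) + 1) * ((M + 1) * ‖y‖)) atTop (𝓝 0) := by
      simpa using (tendsto_one_div_add_atTop_nhds_zero_nat (𝕜 := ℝ)).mul_const ((M + 1) * ‖y‖)
    refine squeeze_zero_norm (fun n ↦ ?_) h3
    have hn : ‖((n : ℂ) + 1)⁻¹‖ = 1 / ((n : ℝ) + 1) := by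
      rw [norm_inv, one_div, ← Nat.cast_add_one, Complex.norm_natCast, Nat.cast_add_one]
    rw [norm_smul, hn]
    gcongr
    calc ‖(T ^ (n + 1)) y - y‖ ≤ ‖(T ^ (n + 1)) y‖ + ‖y‖ := norm_sub_le _ _
      _ ≤ M * ‖y‖ + ‖y‖ := by gcongr; exact (T ^ (n + 1)).le_of_opNorm_le (hM _) y
      _ = (M + 1) * ‖y‖ := by ring
  have h3 := hp.add h2
  rw [add_zero] at h3
  refine tendsto_nhds_unique h1 (h3.congr fun n ↦ ?_)
  simp only [Function.comp_apply, map_smul, map_sum, ← smul_add]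
  congr 1
  have h4 : ∀ k, T ((T ^ k) y) = (T ^ (k + 1)) y := fun k ↦ by rw [pow_succ']; rfl
  simp_rw [h4]
  have h5 := Finset.sum_range_succ' (fun k ↦ (T ^ k) y) (n + 1)
  rw [Finset.sum_range_succ _ (n + 1)] at h5
  rw [pow_zero, one_apply_eq_self] at h5
  rw [← add_sub_assoc, h5, add_sub_cancel_right]

/-- A vector differs from each of its ergodic averages by an element of the range of `1 - T`. -/
lemma exists_one_sub_apply_eq_sub_average (T : X →L[ℂ] X) (y : X) (n : ℕ) :
    ∃ u : X, (1 - T) u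
      = y - ((n : ℂ) + 1)⁻¹ • ∑ k ∈ Finset.range (n + 1), (T ^ k) y := by
  refine ⟨((n : ℂ) + 1)⁻¹ • ∑ k ∈ Finset.range (n + 1), (∑ j ∈ Finset.range k, T ^ j) y, ?_⟩
  have h : ∀ k, (1 - T) ((∑ j ∈ Finset.range k, T ^ j) y) = y - (T ^ k) y := fun k ↦ by
    rw [← mul_apply_eq_comp, mul_neg_geom_sum]; rfl
  have hn : (n : ℂ) + 1 ≠ 0 := Nat.cast_add_one_ne_zero n
  rw [map_smul, map_sum]
  simp_rw [h]
  rw [Finset.sum_sub_distrib, smul_sub, Finset.sum_const, Finset.card_range,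
    ← Nat.cast_smul_eq_nsmul ℂ, smul_smul]
  push_cast
  rw [inv_mul_cancel₀ hn, one_smul]

variable [CompleteSpace X] {T : X →L[ℂ] X} {M : ℝ}

lemma hasSum_oneSubFracPow (hM : ∀ n, ‖T ^ n‖ ≤ M) {α : ℝ} (h0 : 0 ≤ α) :
    HasSum (fun n ↦ (oneSubPowCoeff α n : ℂ) • T ^ n) (oneSubFracPow T α) := by
  refine Summable.hasSum (Summable.of_norm_bounded
    ((summable_abs_oneSubPowCoeff h0).mul_right M) fun n ↦ ?_)
  rw [norm_smul, Complex.norm_real, Real.norm_eq_abs]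
  gcongr
  exact hM n

lemma oneSubFracPow_add_one (hM : ∀ n, ‖T ^ n‖ ≤ M) {α : ℝ} (h0 : 0 ≤ α) :
    oneSubFracPow T (α + 1) = (1 - T) * oneSubFracPow T α := by
  refine (hasSum_oneSubFracPow hM (by linarith)).unique
    ((hasSum_oneSubFracPow hM h0).one_sub_mul_pow_series (by simp) fun k ↦ ?_)
  rw [oneSubPowCoeff_add_one_succ]
  push_cast
  rfl

lemma oneSubFracPow_one (hM : ∀ n, ‖T ^ n‖ ≤ M) : oneSubFracPow T 1 = 1 - T := by
  have h := hasSum_oneSubFracPow hM le_rfl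
  have h' := hasSum_single (f := fun n ↦ (oneSubPowCoeff 0 n : ℂ) • T ^ n) 0 fun n hn ↦ by
    simp [oneSubPowCoeff, Ring.choose_zero_pos ℝ (Nat.pos_of_ne_zero hn)]
  have h1 := oneSubFracPow_add_one hM (le_refl (0 : ℝ))
  rw [zero_add] at h1
  rw [h1, h.unique h']
  simp

lemma commute_oneSubFracPow (hM : ∀ n, ‖T ^ n‖ ≤ M) {α : ℝ} (h0 : 0 ≤ α) :
    Commute T (oneSubFracPow T α) := by
  have h := hasSum_oneSubFracPow hM h0
  refine (h.mul_left T).unique ((h.mul_right T).congr_fun fun n ↦ ?_)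
  rw [mul_smul_comm, smul_mul_assoc, ← pow_succ, ← pow_succ']

/-- The series is cut at `n`. The tail telescopes to `M * q n`; by parts, the head becomes `q n • T
^ n` plus terms `q k • ((1 - T) * T ^ k)`, and `T ^ n` makes each of these `O(q k / n)`. -/
lemma norm_pow_mul_oneSubFracPow_le_of_lt_one {K : ℝ} (hM : ∀ n, ‖T ^ n‖ ≤ M)
    (hK : ∀ n : ℕ, ((n : ℝ) + 1) * ‖T ^ n * (1 - T)‖ ≤ K) {α : ℝ} (h0 : 0 ≤ α) (h1 : α < 1)
    (n : ℕ) :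
    ‖T ^ n * oneSubFracPow T α‖ ≤ (2 * M + K / (1 - α)) * oneSubPowCoeff (α - 1) n := by
  set q := oneSubPowCoeff (α - 1) with hq
  have hqpos : ∀ k, 0 < q k := oneSubPowCoeff_sub_one_pos h1
  have hM0 : 0 ≤ M := (norm_nonneg _).trans (hM 0)
  have hK0 : 0 ≤ K := le_trans (by positivity) (hK 0)
  have hα : 0 < 1 - α := by linarith
  have hsum := (hasSum_nat_add_iff' (n + 1)).2 (hasSum_oneSubFracPow hM h0)
  have htail : ‖T ^ n * (oneSubFracPow T α
      - ∑ k ∈ Finset.range (n + 1), (oneSubPowCoeff α k : ℂ) • T ^ k)‖ ≤ M * q n := by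
    refine le_of_tendsto (hsum.mul_left (T ^ n)).tendsto_sum_nat.norm
      (Eventually.of_forall fun N ↦ ?_)
    calc ‖∑ k ∈ Finset.range N,
          T ^ n * ((oneSubPowCoeff α (k + (n + 1)) : ℂ) • T ^ (k + (n + 1)))‖
        ≤ ∑ k ∈ Finset.range N, (q (k + n) - q (k + 1 + n)) * M := by
          refine norm_sum_le_of_le _ fun k _ ↦ ?_
          rw [mul_smul_comm, ← pow_add, norm_smul, Complex.norm_real, Real.norm_eq_abs,
            ← add_assoc, abs_oneSubPowCoeff_succ h0 h1, add_right_comm]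
          have := oneSubPowCoeff_sub_one_succ_le h0 h1 (k + n)
          rw [add_right_comm] at this
          have h2 : 0 ≤ q (k + n) - q (k + 1 + n) := sub_nonneg.2 this
          exact mul_le_mul_of_nonneg_left (hM _) h2
      _ = (q n - q (N + n)) * M := by
          rw [← Finset.sum_mul, Finset.sum_range_sub' (fun k ↦ q (k + n)), zero_add]
      _ ≤ M * q n := by nlinarith [hqpos (N + n)]
  have hhead : ‖T ^ n * ∑ k ∈ Finset.range (n + 1), (oneSubPowCoeff α k : ℂ) • T ^ k‖
      ≤ M * q n + K / (1 - α) * q n := by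
    rw [sum_oneSubPowCoeff_smul_pow, mul_add, Finset.mul_sum]
    refine (norm_add_le _ _).trans (add_le_add ?_ ?_)
    · rw [mul_smul_comm, ← pow_add, norm_smul, Complex.norm_real, Real.norm_of_nonneg (hqpos n).le,
        mul_comm]
      exact mul_le_mul_of_nonneg_right (hM _) (hqpos n).le
    · calc ‖∑ k ∈ Finset.range n, T ^ n * ((oneSubPowCoeff (α - 1) k : ℂ) • ((1 - T) * T ^ k))‖
          ≤ ∑ k ∈ Finset.range n, q k * (K / (n + 1)) := by
            refine norm_sum_le_of_le _ fun k _ ↦ ?_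
            have hc : T ^ n * ((1 - T) * T ^ k) = T ^ (n + k) * (1 - T) := by
              rw [pow_add, mul_assoc,
                (((Commute.one_left T).sub_left (Commute.refl T)).pow_right k).eq]
            rw [mul_smul_comm, norm_smul, Complex.norm_real, hc, Real.norm_of_nonneg (hqpos k).le]
            refine mul_le_mul_of_nonneg_left ?_ (hqpos k).le
            rw [le_div_iff₀ (by positivity), mul_comm]
            refine le_trans ?_ (hK (n + k))
            gcongr
            linarith [(Nat.cast_nonneg k : (0 : ℝ) ≤ k)]
        _ = K / (1 - α) * q n * (n / (n + 1)) := by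
            rw [← Finset.sum_mul, hq, sum_oneSubPowCoeff_sub_one h1]
            field_simp
        _ ≤ K / (1 - α) * q n * 1 := by
            have := (hqpos n).le
            gcongr
            rw [div_le_one (by positivity)]
            linarith
        _ = _ := mul_one _
  calc ‖T ^ n * oneSubFracPow T α‖ = ‖T ^ n * (oneSubFracPow T α
      - ∑ k ∈ Finset.range (n + 1), (oneSubPowCoeff α k : ℂ) • T ^ k)
      + T ^ n * ∑ k ∈ Finset.range (n + 1), (oneSubPowCoeff α k : ℂ) • T ^ k‖ := by
        rw [← mul_add, sub_add_cancel]
    _ ≤ M * q n + (M * q n + K / (1 - α) * q n) :=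
        (norm_add_le _ _).trans (add_le_add htail hhead)
    _ = _ := by ring

/-- Decay of the powers on the range of `(1 - T) ^ α`, in operator norm. -/
lemma exists_norm_pow_mul_oneSubFracPow_le {K : ℝ} (hM : ∀ n, ‖T ^ n‖ ≤ M)
    (hK : ∀ n : ℕ, ((n : ℝ) + 1) * ‖T ^ n * (1 - T)‖ ≤ K) {α : ℝ} (h0 : 0 ≤ α) :
    ∃ B : ℝ, 0 ≤ B ∧ ∀ n : ℕ, ‖T ^ n * oneSubFracPow T α‖ ≤ B * ((n : ℝ) + 1) ^ (-α) := by
  have hM0 : 0 ≤ M := (norm_nonneg _).trans (hM 0)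
  have hK0 : 0 ≤ K := le_trans (by positivity) (hK 0)
  obtain ⟨m, hm⟩ : ∃ m : ℕ, α < m + 1 := ⟨⌊α⌋₊, Nat.lt_floor_add_one α⟩
  induction m generalizing α with
  | zero =>
    have h1 : α < 1 := by simpa using hm
    have hα : 0 < 1 - α := by linarith
    refine ⟨2 * M + K / (1 - α), by positivity, fun n ↦ ?_⟩
    refine (norm_pow_mul_oneSubFracPow_le_of_lt_one hM hK h0 h1 n).trans ?_
    gcongr
    exact oneSubPowCoeff_sub_one_le_rpow h0 h1 n
  | succ m ih =>
    rcases lt_or_ge α (m + 1) with h | h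
    · exact ih h0 h
    have h0' : 0 ≤ α - 1 := by linarith [(Nat.cast_nonneg m : (0 : ℝ) ≤ m)]
    obtain ⟨B, hB0, hB⟩ := ih h0' (by push_cast at hm; linarith)
    refine ⟨K * B * 2 ^ α, by positivity, fun n ↦ ?_⟩
    -- Each half carries its share of the decay, `1` for `1 - T` and `α - 1` for the rest; halving
    -- `n + 1` costs `2 ^ α`.
    obtain ⟨a, b, hab, ha, hb⟩ : ∃ a b : ℕ, n = a + b ∧ n ≤ 2 * a + 1 ∧ n ≤ 2 * b + 1 :=
      ⟨n / 2, n - n / 2, by omega, by omega, by omega⟩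
    have ha' : ((n : ℝ) + 1) / 2 ≤ a + 1 := by
      have : (n : ℝ) ≤ 2 * a + 1 := by exact_mod_cast ha
      linarith
    have hb' : ((n : ℝ) + 1) / 2 ≤ b + 1 := by
      have : (n : ℝ) ≤ 2 * b + 1 := by exact_mod_cast hb
      linarith
    have hn : (0 : ℝ) < ((n : ℝ) + 1) / 2 := by positivity
    have hF : T ^ n * oneSubFracPow T α
        = T ^ a * (1 - T) * (T ^ b * oneSubFracPow T (α - 1)) := by
      have h2 := oneSubFracPow_add_one hM h0'
      rw [sub_add_cancel] at h2
      rw [h2, hab, pow_add, mul_assoc, mul_assoc, ← mul_assoc (T ^ b), ← mul_assoc (1 - T),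
        (((Commute.one_left T).sub_left (Commute.refl T)).pow_right b).eq]
    have hA : ‖T ^ a * (1 - T)‖ ≤ K * (((n : ℝ) + 1) / 2) ^ (-1 : ℝ) := by
      rw [Real.rpow_neg_one, ← div_eq_mul_inv, le_div_iff₀ hn, mul_comm]
      exact le_trans (by gcongr) (hK a)
    have hB' : ‖T ^ b * oneSubFracPow T (α - 1)‖ ≤ B * (((n : ℝ) + 1) / 2) ^ (-(α - 1)) := by
      refine (hB b).trans (mul_le_mul_of_nonneg_left ?_ hB0)
      exact Real.rpow_le_rpow_of_nonpos hn hb' (by linarith)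
    rw [hF]
    calc ‖T ^ a * (1 - T) * (T ^ b * oneSubFracPow T (α - 1))‖
        ≤ K * (((n : ℝ) + 1) / 2) ^ (-1 : ℝ) * (B * (((n : ℝ) + 1) / 2) ^ (-(α - 1))) :=
          (norm_mul_le _ _).trans (by gcongr)
      _ = K * B * ((((n : ℝ) + 1) / 2) ^ (-1 : ℝ) * (((n : ℝ) + 1) / 2) ^ (-(α - 1))) := by ring
      _ = K * B * (((n : ℝ) + 1) / 2) ^ (-α) := by
          rw [← Real.rpow_add hn]; congr 2; ring
      _ = K * B * 2 ^ α * ((n : ℝ) + 1) ^ (-α) := by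
          rw [Real.div_rpow (by positivity) (by norm_num), Real.rpow_neg zero_le_two, div_inv_eq_mul]
          ring

/-- On a fixed vector `T ^ n (1 - T) ^ α p` does not depend on `n`, yet tends to `0`. -/
lemma oneSubFracPow_apply_eq_zero {K : ℝ} (hM : ∀ n, ‖T ^ n‖ ≤ M)
    (hK : ∀ n : ℕ, ((n : ℝ) + 1) * ‖T ^ n * (1 - T)‖ ≤ K) {α : ℝ} (h0 : 0 < α) {p : X}
    (hp : T p = p) : oneSubFracPow T α p = 0 := by
  obtain ⟨B, -, hB⟩ := exists_norm_pow_mul_oneSubFracPow_le hM hK h0.le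
  have hTp : ∀ n, (T ^ n) p = p := fun n ↦ by
    induction n with
    | zero => rfl
    | succ n ih => rw [pow_succ, mul_apply_eq_comp, hp, ih]
  have hle : ∀ n : ℕ, ‖oneSubFracPow T α p‖ ≤ B * ((n : ℝ) + 1) ^ (-α) * ‖p‖ := fun n ↦ by
    have h := (T ^ n * oneSubFracPow T α).le_of_opNorm_le (hB n) p
    rwa [((commute_oneSubFracPow hM h0.le).pow_left n).eq, mul_apply_eq_comp,
      hTp] at h
  have hlim : Tendsto (fun n : ℕ ↦ B * ((n : ℝ) + 1) ^ (-α) * ‖p‖) atTop (𝓝 0) := by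
    have h := (tendsto_rpow_neg_atTop h0).comp
      (tendsto_atTop_add_const_right atTop (1 : ℝ) tendsto_natCast_atTop_atTop)
    simpa using (h.const_mul B).mul_const ‖p‖
  exact norm_le_zero_iff.1 (ge_of_tendsto' hlim hle)

lemma tendsto_rpow_mul_norm_pow_oneSubFracPow {K : ℝ} (hM : ∀ n, ‖T ^ n‖ ≤ M)
    (hK : ∀ n : ℕ, ((n : ℝ) + 1) * ‖T ^ n * (1 - T)‖ ≤ K) (hme : IsMeanErgodic T) {α : ℝ}
    (h0 : 0 < α) (y : X) :
    Tendsto (fun n : ℕ ↦ ((n : ℝ) + 1) ^ α * ‖(T ^ n) (oneSubFracPow T α y)‖) atTop (𝓝 0) := by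
  obtain ⟨p, hp⟩ := hme y
  have hFp := oneSubFracPow_apply_eq_zero hM hK h0 (apply_eq_of_tendsto_average hM hp)
  obtain ⟨B, hB0, hB⟩ := exists_norm_pow_mul_oneSubFracPow_le hM hK h0.le
  obtain ⟨B', -, hB'⟩ := exists_norm_pow_mul_oneSubFracPow_le hM hK (α := α + 1) (by linarith)
  rw [Metric.tendsto_atTop]
  intro ε hε
  -- `B + 1` rather than `B`, which may vanish.
  obtain ⟨N, hN⟩ := (Metric.tendsto_atTop.1 hp) (ε / (2 * (B + 1))) (by positivity)
  have hN := hN N le_rfl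
  obtain ⟨u, hu⟩ := exists_one_sub_apply_eq_sub_average T y N
  set v := ((N : ℂ) + 1)⁻¹ • ∑ k ∈ Finset.range (N + 1), (T ^ k) y
  rw [dist_eq_norm, lt_div_iff₀ (by positivity)] at hN
  have hlim : Tendsto (fun n : ℕ ↦ 1 / ((n : ℝ) + 1) * (B' * ‖u‖)) atTop (𝓝 0) := by
    simpa using (tendsto_one_div_add_atTop_nhds_zero_nat (𝕜 := ℝ)).mul_const (B' * ‖u‖)
  obtain ⟨n₀, hn₀⟩ := eventually_atTop.1 (hlim.eventually (gt_mem_nhds (half_pos hε)))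
  refine ⟨n₀, fun n hn ↦ ?_⟩
  have hnp : (0 : ℝ) < (n : ℝ) + 1 := by positivity
  rw [Real.dist_0_eq_abs, abs_of_nonneg (by positivity)]
  -- Uses `y = v + (1 - T) u` and `(1 - T) ^ α p = 0`: the first term is small by the choice of `N`,
  -- the second decays one power faster.
  have hy : oneSubFracPow T α y = oneSubFracPow T α (v - p) + oneSubFracPow T (α + 1) u := by
    have h1 : oneSubFracPow T (α + 1) u = oneSubFracPow T α (y - v) := by
      rw [oneSubFracPow_add_one hM h0.le,
        ((Commute.one_left _).sub_left (commute_oneSubFracPow hM h0.le)).eq,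
        mul_apply_eq_comp, hu]
    rw [h1, map_sub, map_sub, hFp]
    abel
  have e1 : ‖(T ^ n) (oneSubFracPow T α (v - p))‖ ≤ B * ((n : ℝ) + 1) ^ (-α) * ‖v - p‖ :=
    (T ^ n * oneSubFracPow T α).le_of_opNorm_le (hB n) _
  have e2 : ‖(T ^ n) (oneSubFracPow T (α + 1) u)‖ ≤ B' * ((n : ℝ) + 1) ^ (-(α + 1)) * ‖u‖ :=
    (T ^ n * oneSubFracPow T (α + 1)).le_of_opNorm_le (hB' n) _
  have r1 : ((n : ℝ) + 1) ^ α * ((n : ℝ) + 1) ^ (-α) = 1 := by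
    rw [← Real.rpow_add hnp, add_neg_cancel, Real.rpow_zero]
  have r2 : ((n : ℝ) + 1) ^ α * ((n : ℝ) + 1) ^ (-(α + 1)) = 1 / ((n : ℝ) + 1) := by
    rw [← Real.rpow_add hnp, show α + -(α + 1) = -1 by ring, Real.rpow_neg_one, one_div]
  calc ((n : ℝ) + 1) ^ α * ‖(T ^ n) (oneSubFracPow T α y)‖
      ≤ ((n : ℝ) + 1) ^ α * (B * ((n : ℝ) + 1) ^ (-α) * ‖v - p‖
          + B' * ((n : ℝ) + 1) ^ (-(α + 1)) * ‖u‖) := by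
        gcongr
        rw [hy, map_add]
        exact (norm_add_le _ _).trans (add_le_add e1 e2)
    _ = (((n : ℝ) + 1) ^ α * ((n : ℝ) + 1) ^ (-α)) * (B * ‖v - p‖)
          + (((n : ℝ) + 1) ^ α * ((n : ℝ) + 1) ^ (-(α + 1))) * (B' * ‖u‖) := by ring
    _ = B * ‖v - p‖ + 1 / ((n : ℝ) + 1) * (B' * ‖u‖) := by rw [r1, r2, one_mul]
    _ < ε := by
        have h2 := hn₀ n hn
        nlinarith [norm_nonneg (v - p)]

end operators

/-! ### The equivalence -/

theorem theorem2p1 {X : Type*} [NormedAddCommGroup X] [NormedSpace ℂ X] [CompleteSpace X]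
    (T : X →L[ℂ] X) (hpb : IsPowerBounded T) (hme : IsMeanErgodic T) :
    IsRittOperator T ↔
      ∀ α : ℝ, 0 < α → ∀ x ∈ Set.range (oneSubFracPow T α),
        (fun n : ℕ => ‖(T ^ n) x‖) =o[atTop] (fun n : ℕ => (n : ℝ) ^ (-α)) := by
  obtain ⟨M, hM⟩ := hpb
  constructor
  · rintro ⟨-, C, hC, h⟩ α h0 x ⟨y, rfl⟩
    obtain ⟨K, hK⟩ := exists_norm_pow_mul_one_sub_le hM hC h
    have hlim := tendsto_rpow_mul_norm_pow_oneSubFracPow hM hK hme h0 y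
    -- The comparison function takes the value `0` at `n = 0`, so it is nonzero only eventually.
    rw [isLittleO_iff_tendsto']
    · refine squeeze_zero (fun n ↦ by positivity) (fun n ↦ ?_) hlim
      rw [Real.rpow_neg (by positivity), div_inv_eq_mul, mul_comm]
      gcongr
      linarith
    · filter_upwards [eventually_gt_atTop 0] with n hn hz
      exact absurd hz (Real.rpow_pos_of_pos (Nat.cast_pos.2 hn) _).ne'
  · intro h
    refine ⟨spectralRadius_le_one_of_pow_bounded hM, ?_⟩
    -- For `α = 1` the hypothesis bounds these operators at each vector; uniform boundedness does
    -- the rest.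
    have hbdd : ∃ K, ∀ n : ℕ, ‖(n : ℂ) • (T ^ n * (1 - T))‖ ≤ K := by
      refine banach_steinhaus fun y ↦ ?_
      have hy := (h 1 one_pos _ ⟨y, rfl⟩).tendsto_div_nhds_zero
      obtain ⟨C, hC⟩ := hy.bddAbove_range
      refine ⟨C, fun n ↦ le_trans (le_of_eq ?_) (hC ⟨n, rfl⟩)⟩
      dsimp only
      rw [oneSubFracPow_one hM, Real.rpow_neg_one, div_inv_eq_mul, smul_apply,
        norm_smul, Complex.norm_natCast, mul_comm, mul_apply_eq_comp]
    obtain ⟨K, hK⟩ := hbdd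
    refine exists_norm_resolvent_le hM (K := K) fun n ↦ ?_
    simpa [norm_smul] using hK n
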